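/- All graphs are finite and non-empty, and multigraphs may have parallel edges. An $r$-regular multigraph $G$ is called an $r$-graph if for every set $X\subseteq V(G)$ with an odd number of vertices, at least $r$ edges of $G$ have one end in $X$ and the other end in $V(G)\setminus X$. The edge-chromatic number $\chi'(G)$ is the smallest number of matchings into which the edge set of $G$ can be partitioned. For every integer $k\ge 0$ and every $(2k+1)$-graph $G$ that does not contain $K_4$ as a minor, $\chi'(G)=2k+1$. -/

import Mathlib

namespace Graph

/-- The degree of a vertex in a multigraph: the number of edges incident with it, loops being
counted twice. -/
noncomputable def vertexDegree {α β : Type*} (G : Graph α β) (v : α) : ℕ∞ :=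
  (G.incidenceSet v).encard + (G.loopSet v).encard

/-- The set of edges leaving `X`, that is, with one end in `X` and the other end outside `X`. -/
def edgesLeaving {α β : Type*} (G : Graph α β) (X : Set α) : Set β :=
  {e | ∃ x y, x ∈ X ∧ y ∉ X ∧ G.IsLink e x y}

/-- An `r`-graph: an `r`-regular multigraph such that at least `r` edges leave
each set `X` of an odd number of vertices. -/
structure IsRGraph {α β : Type*} (G : Graph α β) (r : ℕ) : Prop where
  regular : ∀ v ∈ V(G), G.vertexDegree v = r
  odd_cut : ∀ X ⊆ V(G), X.Finite → Odd X.ncard → (r : ℕ∞) ≤ (G.edgesLeaving X).encard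

/-- The simple graph `H` is a minor of the multigraph `G`: there are pairwise disjoint (nonempty)
connected vertex sets of `G`, one for each vertex of `H`, such that `G` has an edge between
the sets of any two vertices that are adjacent in `H`. -/
def HasMinor {α β γ : Type*} (G : Graph α β) (H : SimpleGraph γ) : Prop :=
  ∃ B : γ → Set V(G),
    (∀ i, (G.toSimpleGraph.induce (B i)).Connected) ∧
    (∀ i j, i ≠ j → Disjoint (B i) (B j)) ∧
    (∀ i j, H.Adj i j → ∃ x ∈ B i, ∃ y ∈ B j, G.Adj x y)

/-- `G` is `K₄`-minor-free. -/
def IsK4MinorFree {α β : Type*} (G : Graph α β) : Prop :=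
  ¬ G.HasMinor (⊤ : SimpleGraph (Fin 4))

/-- A matching: a set of non-loop edges, no two of which share an end. -/
def IsMatching {α β : Type*} (G : Graph α β) (M : Set β) : Prop :=
  M ⊆ E(G) ∧ (∀ e ∈ M, ∀ x, ¬ G.IsLoopAt e x) ∧
    ∀ e ∈ M, ∀ f ∈ M, e ≠ f → ∀ x, ¬ (G.Inc e x ∧ G.Inc f x)

/-- `G` is `n`-edge-colourable: its edge set can be partitioned into `n`
(possibly empty) matchings. -/
def EdgeColourable {α β : Type*} (G : Graph α β) (n : ℕ) : Prop :=
  ∃ M : Fin n → Set β,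
    (∀ i, G.IsMatching (M i)) ∧ (∀ i j, i ≠ j → Disjoint (M i) (M j)) ∧ ⋃ i, M i = E(G)

/-- The edge-chromatic number `χ'(G)`: the smallest `n` such that `G` is `n`-edge-colourable
(`⊤` if there is none). -/
noncomputable def edgeChromaticNumber {α β : Type*} (G : Graph α β) : ℕ∞ :=
  ⨅ n : {n : ℕ // G.EdgeColourable n}, (n.1 : ℕ∞)

end Graph

/-! Each vertex of an `r`-graph has `r` incident edges and no loops, so at least `r` colours are
needed. For the upper bound, `EdgeSystem.exists_isProper` uses induction on the number of vertices,
for every `r > 0`.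

A finite simple graph of minimum degree three has a `K₄`-minor (`hasK4MinorOn_of_three_neighbours`,
by rotating a longest path), so some vertex `v` has at most two neighbours. If its only neighbour is
`a`, regularity makes `{v, a}` a component, which is removed. If it has two neighbours `a` and `b`,
the odd cut of `{v, a, b}` shows that `a` and `b` are not adjacent, and the three vertices are
identified. The result is a smaller `r`-graph without `K₄`-minor. Its colouring lifts because `v` is
joined to `a` by as many edges as leave `b` for vertices other than `v`, and symmetrically, so the
edges at `v` can borrow the colours from the opposite side. -/

/-! ### Minimum degree three forces a `K₄`-minor. -/

/-- `B` is connected with respect to the relation `adj`: it is nonempty, and every set that meets `B`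
and is closed under passing to neighbours in `B` contains `B`. -/
def IsConnectedOn {α : Type*} (adj : α → α → Prop) (B : Set α) : Prop :=
  B.Nonempty ∧ ∀ S : Set α, (S ∩ B).Nonempty → (∀ x ∈ S ∩ B, ∀ y ∈ B, adj x y → y ∈ S) → B ⊆ S

/-- `adj` has a `K₄`-minor with branch sets inside `V`. -/
def HasK4MinorOn {α : Type*} (adj : α → α → Prop) (V : Set α) : Prop :=
  ∃ B : Fin 4 → Set α, (∀ i, B i ⊆ V) ∧ (∀ i, IsConnectedOn adj (B i)) ∧
    (∀ i j, i ≠ j → Disjoint (B i) (B j)) ∧ ∀ i j, i ≠ j → ∃ x ∈ B i, ∃ y ∈ B j, adj x y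

lemma isConnectedOn_image_Icc {α : Type*} {adj : α → α → Prop} (symm : ∀ x y, adj x y → adj y x)
    {f : ℕ → α} {p q : ℕ} (hpq : p ≤ q) (hf : ∀ k, p ≤ k → k < q → adj (f k) (f (k + 1))) :
    IsConnectedOn adj (f '' Set.Icc p q) := by
  refine ⟨⟨f p, p, ⟨le_rfl, hpq⟩, rfl⟩, ?_⟩
  rintro S ⟨_, hS, k, ⟨hpk, hkq⟩, rfl⟩ hclosed
  have up : ∀ l, k ≤ l → l ≤ q → f l ∈ S := by
    intro l hl
    induction l, hl using Nat.le_induction with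
    | base => exact fun _ => hS
    | succ l hl ih =>
      intro hlq
      exact hclosed (f l) ⟨ih (by omega), l, ⟨by omega, by omega⟩, rfl⟩ _
        ⟨l + 1, ⟨by omega, hlq⟩, rfl⟩ (hf l (by omega) (by omega))
  have down : ∀ d, d ≤ k - p → f (k - d) ∈ S := by
    intro d
    induction d with
    | zero => exact fun _ => hS
    | succ d ih =>
      intro hd
      refine hclosed (f (k - d)) ⟨ih (by omega), k - d, ⟨by omega, by omega⟩, rfl⟩ _
        ⟨k - (d + 1), ⟨by omega, by omega⟩, rfl⟩ (symm _ _ ?_)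
      have := hf (k - (d + 1)) (by omega) (by omega)
      rwa [show k - (d + 1) + 1 = k - d by omega] at this
  rintro _ ⟨l, ⟨hpl, hlq⟩, rfl⟩
  rcases le_total k l with h | h
  · exact up l h hlq
  · have := down (k - l) (by omega)
    rwa [show k - (k - l) = l by omega] at this

/-- `f 0, …, f m` is a path of `adj` in `V`. -/
structure IsPathOn {α : Type*} (adj : α → α → Prop) (V : Set α) (m : ℕ) (f : ℕ → α) : Prop where
  mem : ∀ k ≤ m, f k ∈ V
  inj : ∀ k ≤ m, ∀ l ≤ m, f k = f l → k = l
  adj : ∀ k < m, adj (f k) (f (k + 1))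

lemma IsPathOn.cons {α : Type*} {adj : α → α → Prop} {V : Set α} {m : ℕ} {f : ℕ → α}
    (h : IsPathOn adj V m f) {x : α} (hx : x ∈ V) (hadj : adj x (f 0)) (hnot : ∀ k ≤ m, f k ≠ x) :
    IsPathOn adj V (m + 1) (fun k => if k = 0 then x else f (k - 1)) := by
  refine ⟨?_, ?_, ?_⟩
  · intro k hk
    split_ifs
    · exact hx
    · exact h.mem _ (by omega)
  · intro k hk l hl hkl
    split_ifs at hkl
    · omega
    · exact absurd hkl.symm (hnot _ (by omega))
    · exact absurd hkl (hnot _ (by omega))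
    · have := h.inj _ (by omega) _ (by omega) hkl
      omega
  · intro k hk
    rcases k with _ | k
    · simpa using hadj
    · simpa using h.adj k (by omega)

/-- Rotating a path: if the first vertex is adjacent to the `i`-th, the first `i` vertices can be
reversed. -/
lemma IsPathOn.rotate {α : Type*} {adj : α → α → Prop} (symm : ∀ x y, adj x y → adj y x)
    {V : Set α} {m : ℕ} {f : ℕ → α} (h : IsPathOn adj V m f) {i : ℕ} (him : i ≤ m)
    (hadj : adj (f 0) (f i)) :
    IsPathOn adj V m (fun k => if k < i then f (i - 1 - k) else f k) := by
  refine ⟨?_, ?_, ?_⟩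
  · intro k hk
    split_ifs
    · exact h.mem _ (by omega)
    · exact h.mem _ hk
  · intro k hk l hl hkl
    split_ifs at hkl <;> have := h.inj _ (by omega) _ (by omega) hkl <;> omega
  · intro k hk
    split_ifs with h1 h2
    · have := h.adj (i - 1 - (k + 1)) (by omega)
      rw [show i - 1 - (k + 1) + 1 = i - 1 - k by omega] at this
      exact symm _ _ this
    · rw [show i - 1 - k = 0 by omega, show k + 1 = i by omega]
      exact hadj
    · omega
    · exact h.adj k hk

/-- A finite loopless graph in which every vertex has three neighbours has a `K₄`-minor. -/
theorem hasK4MinorOn_of_three_neighbours {α : Type*} {adj : α → α → Prop}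
    (symm : ∀ x y, adj x y → adj y x) (irrefl : ∀ x, ¬ adj x x) {V : Set α} (hfin : V.Finite)
    (hne : V.Nonempty) (hdeg : ∀ v ∈ V, ∀ a b, ∃ c ∈ V, adj v c ∧ c ≠ a ∧ c ≠ b) :
    HasK4MinorOn adj V := by
  classical
  obtain ⟨v, hv⟩ := hne
  have hbound : ∀ m, (∃ f, IsPathOn adj V m f) → m ≤ V.ncard := by
    rintro m ⟨f, hf⟩
    have := Set.ncard_le_ncard (s := f '' Set.Iic m) (t := V)
      (by rintro _ ⟨k, hk, rfl⟩; exact hf.mem k hk) hfin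
    have hinj : Set.InjOn f (Set.Iic m) := fun k hk l hl => hf.inj k hk l hl
    rw [hinj.ncard_image] at this
    have hc : (Set.Iic m).ncard = m + 1 := by
      rw [← Finset.coe_Iic, Set.ncard_coe_finset, Nat.card_Iic]
    omega
  obtain ⟨m, ⟨f₀, hf₀⟩, hmax⟩ : ∃ m, (∃ f, IsPathOn adj V m f) ∧
      ∀ n, (∃ f, IsPathOn adj V n f) → n ≤ m := by
    have h0 : ∃ f, IsPathOn adj V 0 f :=
      ⟨fun _ => v, fun _ _ => hv, fun k hk l hl _ => by omega, fun k hk => by omega⟩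
    refine ⟨Nat.findGreatest (fun m => ∃ f, IsPathOn adj V m f) V.ncard,
      Nat.findGreatest_spec (P := fun m => ∃ f, IsPathOn adj V m f) (Nat.zero_le _) h0,
      fun n hn => Nat.le_findGreatest (hbound n hn) hn⟩
  have hnbr : ∀ f, IsPathOn adj V m f → ∀ x ∈ V, adj (f 0) x → ∃ k, k ≤ m ∧ f k = x := by
    intro f hf x hx hadj
    by_contra! hcon
    have := hmax (m + 1) ⟨_, hf.cons hx (symm _ _ hadj) hcon⟩
    omega
  let last : (ℕ → α) → ℕ → Prop := fun f j =>
    j ≤ m ∧ adj (f 0) (f j) ∧ ∀ k ≤ m, adj (f 0) (f k) → k ≤ j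
  have hlast : ∀ f, IsPathOn adj V m f → ∃ j, last f j := by
    intro f hf
    obtain ⟨c, hc, hadj, -⟩ := hdeg (f 0) (hf.mem 0 (by omega)) v v
    obtain ⟨k, hk, rfl⟩ := hnbr f hf c hc hadj
    refine ⟨Nat.findGreatest (fun j => adj (f 0) (f j)) m, Nat.findGreatest_le _,
      Nat.findGreatest_spec (P := fun j => adj (f 0) (f j)) hk hadj,
      fun k hk h => Nat.le_findGreatest hk h⟩
  -- Among the longest paths, take one whose first vertex has its last neighbour as early as
  -- possible, at index `j`.
  have hex : ∃ j f, IsPathOn adj V m f ∧ last f j := by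
    obtain ⟨j, hj⟩ := hlast f₀ hf₀
    exact ⟨j, f₀, hf₀, hj⟩
  obtain ⟨f, hf, hjm, hadj_j, hj⟩ := Nat.find_spec hex
  have hmin := fun j' => Nat.find_min' hex (m := j')
  set j := Nat.find hex
  obtain ⟨c, hc, hadj_i, hc1, hcj⟩ := hdeg (f 0) (hf.mem 0 (by omega)) (f 1) (f j)
  obtain ⟨i, him, rfl⟩ := hnbr f hf c hc hadj_i
  have hij : i < j := lt_of_le_of_ne (hj i him hadj_i) (fun h => hcj (by rw [h]))
  have hi1 : i ≠ 1 := fun h => hc1 (by rw [h])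
  have hi0 : i ≠ 0 := by
    rintro rfl
    exact irrefl _ hadj_i
  -- The rotated path starts at `f (i - 1)` and agrees with `f` from `i` on. By minimality its last
  -- neighbour has index `l ≥ j > i`, so `f (i - 1)` is adjacent to `f l`.
  have hg := hf.rotate symm him hadj_i
  obtain ⟨l, hl⟩ := hlast _ hg
  have hjl := hmin l ⟨_, hg, hl⟩
  obtain ⟨hlm, hadj_l, -⟩ := hl
  dsimp only at hadj_l
  rw [if_pos (by omega), if_neg (by omega), show i - 1 - 0 = i - 1 by omega] at hadj_l
  have hsub : ∀ p q, q ≤ m → f '' Set.Icc p q ⊆ V := by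
    rintro p q hq _ ⟨k, hk, rfl⟩
    exact hf.mem k (hk.2.trans hq)
  have hconn : ∀ p q, p ≤ q → q ≤ m → IsConnectedOn adj (f '' Set.Icc p q) := fun p q hpq hq =>
    isConnectedOn_image_Icc symm hpq (fun k _ hk => hf.adj k (by omega))
  have hdisj : ∀ p q p' q', q < p' → q ≤ m → q' ≤ m →
      Disjoint (f '' Set.Icc p q) (f '' Set.Icc p' q') := by
    intro p q p' q' h hq hq'
    rw [Set.disjoint_left]
    rintro _ ⟨k, hk, rfl⟩ ⟨k', hk', he⟩
    have := hf.inj k' (hk'.2.trans hq') k (hk.2.trans hq) he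
    have := hk.2
    have := hk'.1
    omega
  -- The branch sets are consecutive segments of the path. Besides the path edges, the chords from
  -- `0` to `i`, from `0` to `j` and from `i - 1` to `l` join them.
  let lo : Fin 4 → ℕ := ![0, i - 1, i, i + 1]
  let hi : Fin 4 → ℕ := ![i - 2, i - 1, i, l]
  have hle : ∀ a, lo a ≤ hi a ∧ hi a ≤ m := by
    intro a
    fin_cases a <;> simp [lo, hi] <;> omega
  have hlt : ∀ a b, a < b → hi a < lo b := by
    intro a b hab
    fin_cases a <;> fin_cases b <;>
      first | (exfalso; revert hab; decide) | (simp [lo, hi]; done) | (simp [lo, hi]; omega)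
  have hedge : ∀ a b, a < b →
      ∃ p q, lo a ≤ p ∧ p ≤ hi a ∧ lo b ≤ q ∧ q ≤ hi b ∧ adj (f p) (f q) := by
    have e1 := hf.adj (i - 2) (by omega)
    rw [show i - 2 + 1 = i - 1 by omega] at e1
    have e2 := hf.adj (i - 1) (by omega)
    rw [show i - 1 + 1 = i by omega] at e2
    have e3 := hf.adj i (by omega)
    intro a b hab
    fin_cases a <;> fin_cases b <;> first | (exfalso; revert hab; decide) | skip
    · exact ⟨i - 2, i - 1, by simp [lo], by simp [hi], by simp [lo], by simp [hi], e1⟩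
    · exact ⟨0, i, by simp [lo], by simp, by simp [lo], by simp [hi], hadj_i⟩
    · exact ⟨0, j, by simp [lo], by simp, hij, hjl, hadj_j⟩
    · exact ⟨i - 1, i, by simp [lo], by simp [hi], by simp [lo], by simp [hi], e2⟩
    · exact ⟨i - 1, l, by simp [lo], by simp [hi], hij.trans_le hjl, le_rfl, hadj_l⟩
    · exact ⟨i, i + 1, by simp [lo], by simp [hi], by simp [lo], hij.trans_le hjl, e3⟩
  refine ⟨fun a => f '' Set.Icc (lo a) (hi a), fun a => hsub _ _ (hle a).2,
    fun a => hconn _ _ (hle a).1 (hle a).2, fun a b hab => ?_, fun a b hab => ?_⟩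
  · rcases lt_or_gt_of_ne hab with h | h
    · exact hdisj _ _ _ _ (hlt a b h) (hle a).2 (hle b).2
    · exact (hdisj _ _ _ _ (hlt b a h) (hle b).2 (hle a).2).symm
  · rcases lt_or_gt_of_ne hab with h | h
    · obtain ⟨p, q, h1, h2, h3, h4, h5⟩ := hedge a b h
      exact ⟨f p, ⟨p, ⟨h1, h2⟩, rfl⟩, f q, ⟨q, ⟨h3, h4⟩, rfl⟩, h5⟩
    · obtain ⟨p, q, h1, h2, h3, h4, h5⟩ := hedge b a h
      exact ⟨f q, ⟨q, ⟨h3, h4⟩, rfl⟩, f p, ⟨p, ⟨h1, h2⟩, rfl⟩, symm _ _ h5⟩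

/-! ### Multigraphs with chosen ends, and the reduction at a vertex. -/

/-- A multigraph given by finite sets of vertices and edges and two end maps. -/
structure EdgeSystem (α β : Type*) where
  /-- the vertices -/
  verts : Finset α
  /-- the edges -/
  edges : Finset β
  /-- the first end of an edge -/
  fst : β → α
  /-- the second end of an edge -/
  snd : β → α

namespace EdgeSystem

variable {α β : Type*}

open Classical in
/-- The edges at a vertex. -/
noncomputable def star (H : EdgeSystem α β) (v : α) : Finset β :=
  {e ∈ H.edges | H.fst e = v ∨ H.snd e = v}

open Classical in
/-- The edges with exactly one end in `X`. -/
noncomputable def cut (H : EdgeSystem α β) (X : Finset α) : Finset β :=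
  {e ∈ H.edges | ¬(H.fst e ∈ X ↔ H.snd e ∈ X)}

/-- Adjacency of vertices. -/
def Adj (H : EdgeSystem α β) (x y : α) : Prop :=
  ∃ e ∈ H.edges, (H.fst e = x ∧ H.snd e = y) ∨ (H.fst e = y ∧ H.snd e = x)

/-- `H` is loopless and `r`-regular, and all its odd cuts have at least `r` edges. -/
structure IsRSystem (H : EdgeSystem α β) (r : ℕ) : Prop where
  fst_mem : ∀ e ∈ H.edges, H.fst e ∈ H.verts
  snd_mem : ∀ e ∈ H.edges, H.snd e ∈ H.verts
  ne : ∀ e ∈ H.edges, H.fst e ≠ H.snd e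
  card_star : ∀ v ∈ H.verts, (H.star v).card = r
  le_cut : ∀ X ⊆ H.verts, Odd X.card → r ≤ (H.cut X).card

/-- `c` is a proper edge-colouring. -/
def IsProper (H : EdgeSystem α β) {r : ℕ} (c : β → Fin r) : Prop :=
  ∀ v ∈ H.verts, Set.InjOn c (H.star v)

open Classical in
/-- The map identifying `v` and `b` with `a`. -/
noncomputable def merge (v a b x : α) : α := if x = v ∨ x = b then a else x

open Classical in
/-- Delete the edges at `v` and identify `v` and `b` with `a`. -/
noncomputable def contract (H : EdgeSystem α β) (v a b : α) : EdgeSystem α β where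
  verts := (H.verts.erase v).erase b
  edges := {e ∈ H.edges | H.fst e ≠ v ∧ H.snd e ≠ v}
  fst := fun e => merge v a b (H.fst e)
  snd := fun e => merge v a b (H.snd e)

variable {H : EdgeSystem α β} {r : ℕ} {v a b : α}

lemma Adj.symm {x y : α} (h : H.Adj x y) : H.Adj y x := by
  obtain ⟨e, he, h⟩ := h
  exact ⟨e, he, h.symm⟩

lemma mem_star {e : β} {x : α} : e ∈ H.star x ↔ e ∈ H.edges ∧ (H.fst e = x ∨ H.snd e = x) := by
  simp [star]

lemma mem_cut {e : β} {X : Finset α} :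
    e ∈ H.cut X ↔ e ∈ H.edges ∧ ¬(H.fst e ∈ X ↔ H.snd e ∈ X) := by
  simp [cut]

lemma mem_contract_edges {e : β} :
    e ∈ (H.contract v a b).edges ↔ e ∈ H.edges ∧ H.fst e ≠ v ∧ H.snd e ≠ v := by
  simp [contract]

lemma mem_contract_verts {x : α} :
    x ∈ (H.contract v a b).verts ↔ x ≠ b ∧ x ≠ v ∧ x ∈ H.verts := by
  simp [contract]

lemma card_contract_verts_lt (hv : v ∈ H.verts) :
    (H.contract v a b).verts.card < H.verts.card :=
  Finset.card_lt_card ⟨fun _ hx => (mem_contract_verts.1 hx).2.2,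
    fun h => (mem_contract_verts.1 (h hv)).2.1 rfl⟩

/-- `v` has no neighbours apart from `a` and `b`. -/
def NeighboursIn (H : EdgeSystem α β) (v a b : α) : Prop := ∀ x, H.Adj v x → x = a ∨ x = b

lemma NeighboursIn.snd_eq (h : H.NeighboursIn v a b) {e : β} (he : e ∈ H.edges)
    (hf : H.fst e = v) : H.snd e = a ∨ H.snd e = b := h _ ⟨e, he, Or.inl ⟨hf, rfl⟩⟩

lemma NeighboursIn.fst_eq (h : H.NeighboursIn v a b) {e : β} (he : e ∈ H.edges)
    (hf : H.snd e = v) : H.fst e = a ∨ H.fst e = b := h _ ⟨e, he, Or.inr ⟨rfl, hf⟩⟩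

/-! ### Reduction at a vertex with one neighbour. -/

section OneNeighbour

/-- If all edges at `v` go to `a`, these are all edges at `a`. -/
lemma star_eq_of_neighboursIn_single (hH : H.IsRSystem r) (hv : v ∈ H.verts) (ha : a ∈ H.verts)
    (h : H.NeighboursIn v a a) : H.star v = H.star a := by
  refine Finset.eq_of_subset_of_card_le (fun e he => ?_)
    (by rw [hH.card_star v hv, hH.card_star a ha])
  rw [mem_star] at he ⊢
  have h1 := h.snd_eq he.1
  have h2 := h.fst_eq he.1
  grind

lemma notMem_ends_of_mem_contract (hs : H.star v = H.star a) {e : β}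
    (he : e ∈ (H.contract v a a).edges) :
    e ∈ H.edges ∧ (H.fst e ≠ v ∧ H.fst e ≠ a) ∧ H.snd e ≠ v ∧ H.snd e ≠ a := by
  rw [mem_contract_edges] at he
  have h1 : e ∉ H.star v := by rw [mem_star]; tauto
  have h2 : e ∉ H.star a := hs ▸ h1
  rw [mem_star] at h2
  tauto

lemma contract_single_ends (hs : H.star v = H.star a) {e : β}
    (he : e ∈ (H.contract v a a).edges) :
    (H.contract v a a).fst e = H.fst e ∧ (H.contract v a a).snd e = H.snd e := by
  have := notMem_ends_of_mem_contract hs he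
  simp only [contract, merge]
  grind

lemma contract_single_star (hs : H.star v = H.star a) {x : α} (hxv : x ≠ v) (hxa : x ≠ a)
    (hedge : ∀ e ∈ H.star v, (H.fst e = v ∨ H.fst e = a) ∧ (H.snd e = v ∨ H.snd e = a)) :
    (H.contract v a a).star x = H.star x := by
  ext e
  have h1 := @contract_single_ends _ _ H v a hs e
  have h2 := hedge e
  simp only [mem_star, mem_contract_edges] at *
  grind

lemma single_edge_ends (h : H.NeighboursIn v a a) :
    ∀ e ∈ H.star v, (H.fst e = v ∨ H.fst e = a) ∧ (H.snd e = v ∨ H.snd e = a) := by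
  intro e he
  rw [mem_star] at he
  have h1 := h.snd_eq he.1
  have h2 := h.fst_eq he.1
  grind

/-- With `b = a`, `contract` erases both `v` and `a`. They span a component, so the remaining stars
and cuts are unchanged. -/
lemma IsRSystem.contract_single (hH : H.IsRSystem r) (hs : H.star v = H.star a)
    (h : H.NeighboursIn v a a) : (H.contract v a a).IsRSystem r := by
  refine ⟨?_, ?_, ?_, ?_, ?_⟩
  · intro e he
    have := notMem_ends_of_mem_contract hs he
    rw [(contract_single_ends hs he).1, mem_contract_verts]
    exact ⟨this.2.1.2, this.2.1.1, hH.fst_mem e this.1⟩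
  · intro e he
    have := notMem_ends_of_mem_contract hs he
    rw [(contract_single_ends hs he).2, mem_contract_verts]
    exact ⟨this.2.2.2, this.2.2.1, hH.snd_mem e this.1⟩
  · intro e he
    rw [(contract_single_ends hs he).1, (contract_single_ends hs he).2]
    exact hH.ne e (notMem_ends_of_mem_contract hs he).1
  · intro x hx
    rw [mem_contract_verts] at hx
    rw [contract_single_star hs hx.2.1 hx.1 (single_edge_ends h)]
    exact hH.card_star x hx.2.2
  · intro X hX hodd
    have hv : v ∉ X := fun h => (mem_contract_verts.1 (hX h)).2.1 rfl
    have ha : a ∉ X := fun h => (mem_contract_verts.1 (hX h)).1 rfl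
    refine (hH.le_cut X (fun x hx => (mem_contract_verts.1 (hX hx)).2.2) hodd).trans
      (Finset.card_le_card fun e he => ?_)
    rw [mem_cut] at he
    have he' : e ∈ (H.contract v a a).edges := by
      rw [mem_contract_edges]
      have h1 := single_edge_ends h e
      rw [mem_star] at h1
      grind
    rw [mem_cut, (contract_single_ends hs he').1, (contract_single_ends hs he').2]
    exact ⟨he', he.2⟩

lemma adj_of_contract_single (hs : H.star v = H.star a) {x y : α}
    (h : (H.contract v a a).Adj x y) : H.Adj x y := by
  obtain ⟨e, he, h⟩ := h
  rw [(contract_single_ends hs he).1, (contract_single_ends hs he).2] at h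
  exact ⟨e, (mem_contract_edges.1 he).1, h⟩

lemma exists_isProper_of_contract_single (hH : H.IsRSystem r) (hs : H.star v = H.star a)
    (h : H.NeighboursIn v a a) (hv : v ∈ H.verts) {c : β → Fin r}
    (hc : (H.contract v a a).IsProper c) : ∃ c' : β → Fin r, H.IsProper c' := by
  classical
  -- The removed component consists of `r` parallel edges, which receive all `r` colours.
  let φ := Finset.equivFinOfCardEq (hH.card_star v hv)
  refine ⟨fun e => if he : e ∈ H.star v then φ ⟨e, he⟩ else c e, fun x hx => ?_⟩
  by_cases hxv : x = v ∨ x = a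
  · have hxs : H.star x = H.star v := by rcases hxv with rfl | rfl <;> simp [hs]
    rw [hxs]
    intro e he f hf hef
    rw [Finset.mem_coe] at he hf
    simpa [he, hf] using hef
  · push Not at hxv
    have hxs := contract_single_star hs hxv.1 hxv.2 (single_edge_ends h)
    have hnot : ∀ e ∈ H.star x, e ∉ H.star v := by
      intro e he he'
      have := single_edge_ends h e he'
      rw [mem_star] at he
      grind
    intro e he f hf hef
    simp only [hnot e he, hnot f hf, dite_false] at hef
    rw [← hxs] at he hf
    exact hc x (mem_contract_verts.2 ⟨hxv.2, hxv.1, hx⟩) he hf hef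

end OneNeighbour

/-! ### Reduction at a vertex with two neighbours. -/

section TwoNeighbours

/-- `v` has exactly the two distinct neighbours `a` and `b`. -/
structure HasTwoNeighbours (H : EdgeSystem α β) (v a b : α) : Prop where
  adj_left : H.Adj v a
  adj_right : H.Adj v b
  ne : a ≠ b
  nbrs : H.NeighboursIn v a b

lemma IsRSystem.mem_of_adj (hH : H.IsRSystem r) {x y : α} (h : H.Adj x y) :
    x ∈ H.verts ∧ y ∈ H.verts ∧ x ≠ y := by
  obtain ⟨e, he, h⟩ := h
  have h1 := hH.fst_mem e he
  have h2 := hH.snd_mem e he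
  have h3 := hH.ne e he
  grind

open Classical in
lemma star_inter_star (hH : H.IsRSystem r) (h : H.HasTwoNeighbours v a b) :
    Disjoint (H.star v ∩ H.star a) (H.star v ∩ H.star b) ∧
      (H.star v ∩ H.star a) ∪ (H.star v ∩ H.star b) = H.star v := by
  have h1 := (hH.mem_of_adj h.adj_left).2.2
  have h2 := (hH.mem_of_adj h.adj_right).2.2
  have h3 := h.ne
  constructor
  · rw [Finset.disjoint_left]
    intro e he hf
    simp only [Finset.mem_inter, mem_star] at he hf
    have := hH.ne e he.1.1
    grind
  · ext e
    simp only [Finset.mem_union, Finset.mem_inter, mem_star]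
    have h4 := @NeighboursIn.fst_eq _ _ _ _ _ _ h.nbrs e
    have h5 := @NeighboursIn.snd_eq _ _ _ _ _ _ h.nbrs e
    grind

open Classical in
lemma card_star_sdiff (hH : H.IsRSystem r) (h : H.HasTwoNeighbours v a b) :
    (H.star a \ H.star v).card = (H.star v ∩ H.star b).card ∧
      (H.star b \ H.star v).card = (H.star v ∩ H.star a).card := by
  have hm := hH.mem_of_adj h.adj_left
  have hm' := hH.mem_of_adj h.adj_right
  have h1 := Finset.card_sdiff_add_card_inter (H.star a) (H.star v)
  have h2 := Finset.card_sdiff_add_card_inter (H.star b) (H.star v)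
  obtain ⟨h3, h4⟩ := star_inter_star hH h
  have h5 := Finset.card_union_of_disjoint h3
  rw [h4, hH.card_star _ hm.1] at h5
  rw [Finset.inter_comm, hH.card_star _ hm.2.1] at h1
  rw [Finset.inter_comm, hH.card_star _ hm'.2.1] at h2
  omega

open Classical in
/-- The two neighbours of `v` are not adjacent: this is forced by the cut of `{v, a, b}`. -/
lemma disjoint_star_sdiff (hH : H.IsRSystem r) (h : H.HasTwoNeighbours v a b) :
    Disjoint (H.star a \ H.star v) (H.star b \ H.star v) := by
  have hm := hH.mem_of_adj h.adj_left
  have hm' := hH.mem_of_adj h.adj_right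
  have hab := h.ne
  have hX : ({v, a, b} : Finset α).card = 3 := by
    rw [Finset.card_eq_three]
    exact ⟨v, a, b, hm.2.2, hm'.2.2, h.ne, rfl⟩
  have hcut := hH.le_cut {v, a, b} (by intro x hx; simp at hx; grind) (by rw [hX]; decide)
  set A := H.star a \ H.star v with hA
  set B := H.star b \ H.star v with hB
  have hdisj : Disjoint (H.cut {v, a, b}) (A ∩ B) := by
    rw [Finset.disjoint_left]
    intro e he hf
    simp only [hA, hB, Finset.mem_inter, Finset.mem_sdiff, mem_star, mem_cut, Finset.mem_insert,
      Finset.mem_singleton] at he hf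
    grind
  have hsub : H.cut {v, a, b} ∪ A ∩ B ⊆ A ∪ B := by
    intro e he
    have h4 := @NeighboursIn.fst_eq _ _ _ _ _ _ h.nbrs e
    have h5 := @NeighboursIn.snd_eq _ _ _ _ _ _ h.nbrs e
    simp only [hA, hB, Finset.mem_union, Finset.mem_inter, Finset.mem_sdiff, mem_star, mem_cut,
      Finset.mem_insert, Finset.mem_singleton] at he ⊢
    grind
  -- Since `|A| + |B| = r`, this gives `r + |A ∩ B| ≤ |A ∪ B| = r - |A ∩ B|`, so `A ∩ B` is empty.
  have h1 := Finset.card_le_card hsub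
  rw [Finset.card_union_of_disjoint hdisj] at h1
  have h2 := Finset.card_union_add_card_inter A B
  obtain ⟨h3, h4⟩ := card_star_sdiff hH h
  rw [← hA] at h3
  rw [← hB] at h4
  obtain ⟨h5, h6⟩ := star_inter_star hH h
  have h7 := Finset.card_union_of_disjoint h5
  rw [h6, hH.card_star _ hm.1] at h7
  rw [Finset.disjoint_iff_inter_eq_empty, ← Finset.card_eq_zero]
  omega

lemma merge_eq_left {x : α} : merge v a b x = a ↔ x = v ∨ x = a ∨ x = b := by
  simp only [merge]
  grind

lemma merge_of_ne {x : α} (hv : x ≠ v) (hb : x ≠ b) : merge v a b x = x := by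
  simp [merge, hv, hb]

open Classical in
lemma contract_star_left : (H.contract v a b).star a =
    (H.star a \ H.star v) ∪ (H.star b \ H.star v) := by
  ext e
  simp only [mem_star, mem_contract_edges, Finset.mem_union, Finset.mem_sdiff]
  simp only [contract, merge_eq_left]
  grind

lemma contract_star_of_ne (h : H.HasTwoNeighbours v a b) {x : α} (hv : x ≠ v) (ha : x ≠ a)
    (hb : x ≠ b) : (H.contract v a b).star x = H.star x := by
  ext e
  have h4 := @NeighboursIn.fst_eq _ _ _ _ _ _ h.nbrs e
  have h5 := @NeighboursIn.snd_eq _ _ _ _ _ _ h.nbrs e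
  simp only [mem_star, mem_contract_edges]
  simp only [contract, merge]
  grind

lemma IsRSystem.contract (hH : H.IsRSystem r) (h : H.HasTwoNeighbours v a b) :
    (H.contract v a b).IsRSystem r := by
  classical
  have hm := hH.mem_of_adj h.adj_left
  have hm' := hH.mem_of_adj h.adj_right
  have hab := h.ne
  have hdisj := disjoint_star_sdiff hH h
  have hmerge : ∀ x ∈ H.verts, merge v a b x ∈ (H.contract v a b).verts := by
    intro x hx
    rw [mem_contract_verts]
    simp only [merge]
    grind
  refine ⟨?_, ?_, ?_, ?_, ?_⟩
  · exact fun e he => hmerge _ (hH.fst_mem e (mem_contract_edges.1 he).1)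
  · exact fun e he => hmerge _ (hH.snd_mem e (mem_contract_edges.1 he).1)
  · intro e he heq
    rw [mem_contract_edges] at he
    have h1 := hH.ne e he.1
    rw [Finset.disjoint_left] at hdisj
    have h2 := @hdisj e
    simp only [Finset.mem_sdiff, mem_star] at h2
    simp only [EdgeSystem.contract, merge] at heq
    grind
  · intro x hx
    rw [mem_contract_verts] at hx
    by_cases hxa : x = a
    · subst hxa
      rw [contract_star_left, Finset.card_union_of_disjoint hdisj]
      obtain ⟨h3, h4⟩ := card_star_sdiff hH h
      obtain ⟨h5, h6⟩ := star_inter_star hH h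
      have h7 := Finset.card_union_of_disjoint h5
      rw [h6, hH.card_star _ hm.1] at h7
      omega
    · rw [contract_star_of_ne h hx.2.1 hxa hx.1]
      exact hH.card_star x hx.2.2
  · intro X hX hodd
    have hvX : v ∉ X := fun h => (mem_contract_verts.1 (hX h)).2.1 rfl
    have hbX : b ∉ X := fun h => (mem_contract_verts.1 (hX h)).1 rfl
    have hXV : X ⊆ H.verts := fun x hx => (mem_contract_verts.1 (hX hx)).2.2
    -- `Y` is the preimage of `X` under `merge`. It gains either nothing or the two vertices `v` and
    -- `b`, so it stays odd.
    obtain ⟨Y, hYV, hYodd, hY⟩ : ∃ Y ⊆ H.verts, Odd Y.card ∧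
        ∀ x, x ∈ Y ↔ merge v a b x ∈ X := by
      by_cases haX : a ∈ X
      · refine ⟨insert v (insert b X), ?_, ?_, ?_⟩
        · intro x hx
          simp only [Finset.mem_insert] at hx
          grind
        · rw [Finset.card_insert_of_notMem (by simp [hvX, hm'.2.2]),
            Finset.card_insert_of_notMem hbX, add_assoc]
          exact hodd.add_even (by decide)
        · intro x
          simp only [Finset.mem_insert, merge]
          grind
      · refine ⟨X, hXV, hodd, fun x => ?_⟩
        simp only [merge]
        grind
    refine (hH.le_cut Y hYV hYodd).trans (Finset.card_le_card fun e he => ?_)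
    rw [mem_cut] at he ⊢
    rw [hY, hY] at he
    refine ⟨?_, he.2⟩
    rw [mem_contract_edges]
    have h4 := @NeighboursIn.fst_eq _ _ _ _ _ _ h.nbrs e he.1
    have h5 := @NeighboursIn.snd_eq _ _ _ _ _ _ h.nbrs e he.1
    simp only [merge] at he
    grind

/-- Preimages of the branch sets under `merge` work, because the only nontrivial fibre `{v, a, b}`
is connected through `v`. -/
lemma HasK4MinorOn.of_contract (hH : H.IsRSystem r) (h : H.HasTwoNeighbours v a b)
    (hK : HasK4MinorOn (H.contract v a b).Adj (H.contract v a b).verts) :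
    HasK4MinorOn H.Adj H.verts := by
  obtain ⟨B, hBV, hconn, hdisj, hedge⟩ := hK
  have hm := hH.mem_of_adj h.adj_left
  have hm' := hH.mem_of_adj h.adj_right
  have hself : ∀ x ∈ (H.contract v a b).verts, merge v a b x = x := fun x hx =>
    merge_of_ne (mem_contract_verts.1 hx).2.1 (mem_contract_verts.1 hx).1
  have hlift : ∀ {x y}, (H.contract v a b).Adj x y →
      ∃ x' ∈ H.verts, ∃ y' ∈ H.verts, H.Adj x' y' ∧ merge v a b x' = x ∧ merge v a b y' = y := by
    rintro x y ⟨e, he, hxy⟩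
    have he' := (mem_contract_edges.1 he).1
    rcases hxy with ⟨h1, h2⟩ | ⟨h1, h2⟩
    · exact ⟨_, hH.fst_mem e he', _, hH.snd_mem e he', ⟨e, he', Or.inl ⟨rfl, rfl⟩⟩, h1, h2⟩
    · exact ⟨_, hH.snd_mem e he', _, hH.fst_mem e he', ⟨e, he', Or.inr ⟨rfl, rfl⟩⟩, h2, h1⟩
  refine ⟨fun i => {x | x ∈ H.verts ∧ merge v a b x ∈ B i}, fun i x hx => hx.1,
    fun i => ⟨?_, ?_⟩, fun i j hij => ?_, fun i j hij => ?_⟩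
  · obtain ⟨x, hx⟩ := (hconn i).1
    exact ⟨x, (mem_contract_verts.1 (hBV i hx)).2.2, by rwa [hself x (hBV i hx)]⟩
  · rintro S ⟨x₀, hx₀S, hx₀⟩ hclosed
    -- A closed set is a union of fibres here, so its image is closed in the contraction.
    have hsat : ∀ x ∈ S, x ∈ H.verts → merge v a b x ∈ B i → ∀ y ∈ H.verts,
        merge v a b y = merge v a b x → y ∈ S := by
      intro x hxS hx hxB y hy hyx
      by_cases hxy : y = x
      · rwa [hxy]
      have hcl : ∀ p ∈ S, p ∈ H.verts → ∀ q ∈ H.verts, merge v a b p = merge v a b x →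
          merge v a b q = merge v a b x → H.Adj p q → q ∈ S := by
        intro p hpS hp q hq hpx hqx hpq
        exact hclosed p ⟨hpS, hp, by rwa [hpx]⟩ q ⟨hq, by rwa [hqx]⟩ hpq
      have hxT : x = v ∨ x = a ∨ x = b := by
        simp only [merge] at hyx
        grind
      have hxa : merge v a b x = a := merge_eq_left.2 hxT
      have hyT : y = v ∨ y = a ∨ y = b := merge_eq_left.1 (hyx.trans hxa)
      rw [hxa] at hcl
      have hvm : merge v a b v = a := merge_eq_left.2 (Or.inl rfl)
      have ham : merge v a b a = a := merge_eq_left.2 (Or.inr (Or.inl rfl))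
      have hbm : merge v a b b = a := merge_eq_left.2 (Or.inr (Or.inr rfl))
      have hvS : v ∈ S := by
        rcases hxT with rfl | rfl | rfl
        · exact hxS
        · exact hcl _ hxS hx v hm.1 ham hvm h.adj_left.symm
        · exact hcl _ hxS hx v hm.1 hbm hvm h.adj_right.symm
      rcases hyT with rfl | rfl | rfl
      · exact hvS
      · exact hcl v hvS hm.1 _ hy hvm ham h.adj_left
      · exact hcl v hvS hm.1 _ hy hvm hbm h.adj_right
    have hsub := (hconn i).2 {z | ∃ x ∈ S, x ∈ H.verts ∧ merge v a b x = z}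
      ⟨merge v a b x₀, ⟨x₀, hx₀S, hx₀.1, rfl⟩, hx₀.2⟩ (by
        rintro _ ⟨⟨x, hxS, hx, rfl⟩, hxB⟩ y hy hxy
        obtain ⟨x', hx', y', hy', hadj, hx'x, rfl⟩ := hlift hxy
        exact ⟨y', hclosed x' ⟨hsat x hxS hx hxB x' hx' hx'x, hx', by rwa [hx'x]⟩ y'
          ⟨hy', hy⟩ hadj, hy', rfl⟩)
    rintro y ⟨hy, hyB⟩
    obtain ⟨x, hxS, hx, hxy⟩ := hsub hyB
    exact hsat x hxS hx (by rwa [hxy]) y hy hxy.symm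
  · have := hdisj i j hij
    rw [Set.disjoint_left] at this ⊢
    exact fun x hx hx' => this hx.2 hx'.2
  · obtain ⟨x, hx, y, hy, hxy⟩ := hedge i j hij
    obtain ⟨x', hx', y', hy', hadj, rfl, rfl⟩ := hlift hxy
    exact ⟨x', ⟨hx', hx⟩, y', ⟨hy', hy⟩, hadj⟩

lemma exists_bijOn_of_card_eq {s t : Finset β} (h : s.card = t.card) :
    ∃ g : β → β, Set.BijOn g s t := by
  classical
  let φ := Finset.equivOfCardEq h
  refine ⟨fun x => if hx : x ∈ s then φ ⟨x, hx⟩ else x, ?_, ?_, ?_⟩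
  · intro x hx
    rw [Finset.mem_coe] at hx
    simp [hx]
  · intro x hx y hy hxy
    rw [Finset.mem_coe] at hx hy
    simpa [hx, hy, Subtype.ext_iff.symm] using hxy
  · intro y hy
    rw [Finset.mem_coe] at hy
    refine ⟨φ.symm ⟨y, hy⟩, (φ.symm ⟨y, hy⟩).2, by simp⟩

/-- The merged vertex sees the edges leaving `a` and those leaving `b` in different colours. The
edges `va` copy the colours leaving `b`, and the edges `vb` those leaving `a`. Each of `v`, `a`, `b`
then sees the colours of the merged vertex once. -/
lemma exists_isProper_of_contract (hH : H.IsRSystem r) (h : H.HasTwoNeighbours v a b)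
    {c : β → Fin r} (hc : (H.contract v a b).IsProper c) : ∃ c' : β → Fin r, H.IsProper c' := by
  classical
  have hm := hH.mem_of_adj h.adj_left
  have hm' := hH.mem_of_adj h.adj_right
  have hab := h.ne
  obtain ⟨hA, hB⟩ := card_star_sdiff hH h
  obtain ⟨hVdisj, hV⟩ := star_inter_star hH h
  have hdisj := disjoint_star_sdiff hH h
  have hca := hc a (mem_contract_verts.2 ⟨hab, hm.2.2.symm, hm.2.1⟩)
  rw [contract_star_left] at hca
  obtain ⟨g, hg⟩ := exists_bijOn_of_card_eq hB.symm
  obtain ⟨k, hk⟩ := exists_bijOn_of_card_eq hA.symm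
  let f : β → β := fun e => if e ∈ H.star v then (if e ∈ H.star a then g e else k e) else e
  have hfa : ∀ e ∈ H.star v ∩ H.star a, f e = g e := by
    intro e he
    rw [Finset.mem_inter] at he
    simp [f, he]
  have hfb : ∀ e ∈ H.star v ∩ H.star b, f e = k e := by
    intro e he
    have : e ∉ H.star a := fun ha =>
      Finset.disjoint_left.1 hVdisj (Finset.mem_inter.2 ⟨(Finset.mem_inter.1 he).1, ha⟩) he
    rw [Finset.mem_inter] at he
    simp [f, he, this]
  have hf0 : ∀ e ∉ H.star v, f e = e := by
    intro e he
    simp [f, he]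
  have hg' : Set.BijOn f ↑(H.star v ∩ H.star a) ↑(H.star b \ H.star v) :=
    hg.congr fun e he => (hfa e he).symm
  have hk' : Set.BijOn f ↑(H.star v ∩ H.star b) ↑(H.star a \ H.star v) :=
    hk.congr fun e he => (hfb e he).symm
  have hid : ∀ s : Finset β, Set.BijOn f ↑(s \ H.star v) ↑(s \ H.star v) := fun s =>
    (Set.bijOn_id _).congr fun e he => (hf0 e (Finset.mem_sdiff.1 he).2).symm
  have key : ∀ {s t s' t' : Finset β}, Set.BijOn f s s' → Set.BijOn f t t' → Disjoint s' t' →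
      s' ∪ t' = (H.star a \ H.star v) ∪ (H.star b \ H.star v) →
      -- Applied to the stars of `v`, `a` and `b`, each split into two parts that `f` maps onto the
      -- two halves of the star of the merged vertex.
      Set.InjOn (c ∘ f) ↑(s ∪ t) := by
    intro s t s' t' hs ht hst hu
    refine hca.comp (t := ↑((H.star a \ H.star v) ∪ (H.star b \ H.star v))) ?_ ?_
    · intro x hx y hy hxy
      rw [Finset.mem_coe, Finset.mem_union] at hx hy
      rw [Finset.disjoint_left] at hst
      rcases hx with hx | hx <;> rcases hy with hy | hy
      · exact hs.injOn hx hy hxy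
      · exact absurd (ht.mapsTo hy) (hst (hxy ▸ hs.mapsTo hx))
      · exact absurd (ht.mapsTo hx) (hst (hxy.symm ▸ hs.mapsTo hy))
      · exact ht.injOn hx hy hxy
    · rw [← hu, Finset.coe_union, Finset.coe_union]
      exact hs.mapsTo.union_union ht.mapsTo
  refine ⟨c ∘ f, fun x hx => ?_⟩
  by_cases hxv : x = v
  · rw [hxv, ← hV]
    exact key hg' hk' hdisj.symm (Finset.union_comm _ _)
  by_cases hxa : x = a
  · rw [hxa, ← Finset.sdiff_union_inter (H.star a) (H.star v), Finset.inter_comm]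
    exact key (hid _) hg' hdisj rfl
  by_cases hxb : x = b
  · rw [hxb, ← Finset.sdiff_union_inter (H.star b) (H.star v), Finset.inter_comm]
    exact key (hid _) hk' hdisj.symm (Finset.union_comm _ _)
  have hcx := hc x (mem_contract_verts.2 ⟨hxb, hxv, hx⟩)
  rw [contract_star_of_ne h hxv hxa hxb] at hcx
  refine hcx.congr fun e he => ?_
  have : e ∉ H.star v := by
    intro he'
    have h4 := @NeighboursIn.fst_eq _ _ _ _ _ _ h.nbrs e
    have h5 := @NeighboursIn.snd_eq _ _ _ _ _ _ h.nbrs e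
    rw [Finset.mem_coe] at he
    rw [mem_star] at he he'
    grind
  simp [hf0 e this]

end TwoNeighbours

/-! ### The induction. -/

lemma HasK4MinorOn.of_contract_single (hs : H.star v = H.star a)
    (hK : HasK4MinorOn (H.contract v a a).Adj (H.contract v a a).verts) :
    HasK4MinorOn H.Adj H.verts := by
  obtain ⟨B, hBV, hconn, hdisj, hedge⟩ := hK
  refine ⟨B, fun i x hx => (mem_contract_verts.1 (hBV i hx)).2.2, fun i => ⟨(hconn i).1,
    fun S hS hcl => (hconn i).2 S hS fun x hx y hy hxy =>
      hcl x hx y hy (adj_of_contract_single hs hxy)⟩, hdisj, fun i j hij => ?_⟩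
  obtain ⟨x, hx, y, hy, hxy⟩ := hedge i j hij
  exact ⟨x, hx, y, hy, adj_of_contract_single hs hxy⟩

/-- Every `r`-graph without `K₄`-minor has a proper edge-colouring with `r` colours. -/
theorem exists_isProper (hr : 0 < r) (H : EdgeSystem α β) (hH : H.IsRSystem r)
    (hK : ¬ HasK4MinorOn H.Adj H.verts) : ∃ c : β → Fin r, H.IsProper c := by
  induction hn : H.verts.card using Nat.strong_induction_on generalizing H with
  | _ n ih =>
  subst hn
  rcases H.verts.eq_empty_or_nonempty with hempty | hne
  · exact ⟨fun _ => ⟨0, hr⟩, fun v hv => by simp [hempty] at hv⟩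
  obtain ⟨v, hv, a, b, hab⟩ : ∃ v ∈ H.verts, ∃ a b, H.NeighboursIn v a b := by
    by_contra! hcon
    refine hK (hasK4MinorOn_of_three_neighbours (fun _ _ => Adj.symm)
      (fun x hx => (hH.mem_of_adj hx).2.2 rfl) H.verts.finite_toSet hne fun v hv a b => ?_)
    have := hcon v hv a b
    rw [NeighboursIn] at this
    push Not at this
    obtain ⟨c, hc, hca, hcb⟩ := this
    exact ⟨c, (hH.mem_of_adj hc).2.1, hc, hca, hcb⟩
  have hsingle : ∀ a, H.NeighboursIn v a a → ∃ c : β → Fin r, H.IsProper c := by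
    intro a hva
    have ha : a ∈ H.verts := by
      -- Here `0 < r` is needed: an isolated `v` would satisfy `NeighboursIn` for every `a`.
      obtain ⟨e, he⟩ : (H.star v).Nonempty := by
        rw [← Finset.card_pos, hH.card_star v hv]
        exact hr
      rw [mem_star] at he
      have h1 := hH.fst_mem e he.1
      have h2 := hH.snd_mem e he.1
      have h3 := @NeighboursIn.fst_eq _ _ _ _ _ _ hva e he.1
      have h4 := @NeighboursIn.snd_eq _ _ _ _ _ _ hva e he.1
      grind
    have hs := star_eq_of_neighboursIn_single hH hv ha hva
    obtain ⟨c, hc⟩ := ih _ (card_contract_verts_lt hv) (H.contract v a a)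
      (hH.contract_single hs hva) (fun h => hK (HasK4MinorOn.of_contract_single hs h)) rfl
    exact exists_isProper_of_contract_single hH hs hva hv hc
  by_cases hva : H.Adj v a
  swap
  · exact hsingle b fun x hx => (hab x hx).elim (fun h => absurd (h ▸ hx) hva) (fun h => Or.inl h)
  by_cases hvb : H.Adj v b
  swap
  · exact hsingle a fun x hx => (hab x hx).elim (fun h => Or.inl h) (fun h => absurd (h ▸ hx) hvb)
  by_cases heq : a = b
  · subst heq
    exact hsingle a hab
  have h : H.HasTwoNeighbours v a b := ⟨hva, hvb, heq, hab⟩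
  obtain ⟨c, hc⟩ := ih _ (card_contract_verts_lt hv) (H.contract v a b)
    (hH.contract h) (fun hK' => hK (HasK4MinorOn.of_contract hH h hK')) rfl
  exact exists_isProper_of_contract hH h hc

end EdgeSystem

/-! ### Transfer to `Graph`. -/

namespace Graph

variable {α β : Type*} {G : Graph α β}

/-- The odd cut of `{v}` already uses up the degree `r`, and each loop would add two more. -/
lemma IsRGraph.loopSet_eq_empty {r : ℕ} (hG : G.IsRGraph r) {v : α} (hv : v ∈ V(G)) :
    G.loopSet v = ∅ := by
  have hdeg := hG.regular v hv
  have hcut := hG.odd_cut {v} (by simpa using hv) (Set.finite_singleton v) (by simp)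
  have hsub : G.edgesLeaving {v} ∪ G.loopSet v ⊆ G.incidenceSet v := by
    rintro e (⟨x, y, rfl, -, h⟩ | he)
    · exact ⟨y, h⟩
    · exact G.loopSet_subset_incidenceSet v he
  have hdisj : Disjoint (G.edgesLeaving {v}) (G.loopSet v) := by
    rw [Set.disjoint_left]
    rintro e ⟨x, y, rfl, hy, h⟩ he
    rw [mem_loopSet] at he
    rcases G.eq_or_eq_of_isLink_of_isLink h.symm he with h | h <;> exact hy h
  have h1 := Set.encard_le_encard hsub
  rw [Set.encard_union_eq hdisj] at h1
  have h2 : (r : ℕ∞) + (G.loopSet v).encard + (G.loopSet v).encard ≤ r :=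
    (add_le_add_left ((add_le_add_left hcut _).trans h1) _).trans hdeg.le
  rw [← Set.encard_eq_zero]
  generalize (G.loopSet v).encard = l at h2
  cases l with
  | top => simp at h2
  | coe l =>
    norm_cast at h2 ⊢
    omega

lemma IsRGraph.encard_incidenceSet {r : ℕ} (hG : G.IsRGraph r) {v : α} (hv : v ∈ V(G)) :
    (G.incidenceSet v).encard = r := by
  have := hG.regular v hv
  rwa [vertexDegree, hG.loopSet_eq_empty hv, Set.encard_empty, add_zero] at this

/-- A proper colouring needs as many colours as there are edges at a vertex. -/
lemma EdgeColourable.encard_incidenceSet_le {n : ℕ} (h : G.EdgeColourable n) (v : α) :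
    (G.incidenceSet v).encard ≤ n := by
  obtain ⟨M, hM, -, hcover⟩ := h
  have hex : ∀ e : G.incidenceSet v, ∃ i, e.1 ∈ M i := fun e => by
    rw [← Set.mem_iUnion, hcover]
    exact G.incidenceSet_subset_edgeSet v e.2
  choose c hc using hex
  have hinj : Function.Injective c := by
    intro e f hef
    by_contra hne
    exact (hM (c e)).2.2 e (hc e) f (hef ▸ hc f) (fun h => hne (Subtype.ext h)) v ⟨e.2, f.2⟩
  rw [Set.encard]
  simpa using ENat.card_le_card_of_injective hinj

lemma isConnectedOn_induce {adj : α → α → Prop}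
    (hadj : ∀ x y, adj x y → x ≠ y ∧ G.Adj x y) {B : Set α} (hBV : B ⊆ V(G))
    (hB : IsConnectedOn adj B) :
    (G.toSimpleGraph.induce (Subtype.val ⁻¹' B : Set V(G))).Connected := by
  obtain ⟨⟨x₀, hx₀⟩, hB⟩ := hB
  have : Nonempty (Subtype.val ⁻¹' B : Set V(G)) := ⟨⟨⟨x₀, hBV hx₀⟩, hx₀⟩⟩
  refine ⟨fun u w => ?_⟩
  -- The set of vertices reachable from `u` is closed, so it contains `B`.
  have hw := hB {x | ∃ h : x ∈ B, (G.toSimpleGraph.induce (Subtype.val ⁻¹' B : Set V(G))).Reachable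
    u ⟨⟨x, hBV h⟩, h⟩} ⟨u.1.1, ⟨u.2, SimpleGraph.Reachable.refl _⟩, u.2⟩ (by
      rintro x ⟨⟨hx, hux⟩, -⟩ y hy hxy
      exact ⟨hy, hux.trans (SimpleGraph.Adj.reachable
        ⟨fun h => (hadj x y hxy).1 (congrArg Subtype.val h), (hadj x y hxy).2⟩)⟩) w.2
  exact hw.2

lemma hasMinor_of_hasK4MinorOn {adj : α → α → Prop}
    (hadj : ∀ x y, adj x y → x ≠ y ∧ G.Adj x y) (h : HasK4MinorOn adj V(G)) :
    G.HasMinor (⊤ : SimpleGraph (Fin 4)) := by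
  obtain ⟨B, hBV, hconn, hdisj, hedge⟩ := h
  refine ⟨fun i => Subtype.val ⁻¹' B i, fun i => isConnectedOn_induce hadj (hBV i) (hconn i),
    fun i j hij => (hdisj i j hij).preimage _, fun i j hij => ?_⟩
  obtain ⟨x, hx, y, hy, hxy⟩ := hedge i j hij.ne
  exact ⟨⟨x, hBV i hx⟩, hx, ⟨y, hBV j hy⟩, hy, (hadj x y hxy).2⟩

theorem edgeColourable_of_isK4MinorFree (hV : V(G).Finite) (hE : E(G).Finite)
    (hne : V(G).Nonempty) {r : ℕ} (hr : 0 < r) (hG : G.IsRGraph r) (hminor : G.IsK4MinorFree) :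
    G.EdgeColourable r := by
  have : Nonempty α := ⟨hne.some⟩
  -- The end maps must be total on `β`; non-edges get an arbitrary vertex.
  have hends : ∀ e, ∃ x y, e ∈ E(G) → G.IsLink e x y := by
    intro e
    by_cases he : e ∈ E(G)
    · obtain ⟨x, y, h⟩ := G.exists_isLink_of_mem_edgeSet he
      exact ⟨x, y, fun _ => h⟩
    · exact ⟨hne.some, hne.some, fun h => absurd h he⟩
  choose s t hst using hends
  let H : EdgeSystem α β := ⟨hV.toFinset, hE.toFinset, s, t⟩
  have hHV : (H.verts : Set α) = V(G) := hV.coe_toFinset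
  have hmemE : ∀ {e}, e ∈ H.edges ↔ e ∈ E(G) := hE.mem_toFinset
  have hmemV : ∀ {x}, x ∈ H.verts ↔ x ∈ V(G) := hV.mem_toFinset
  have hsmem : ∀ e ∈ E(G), s e ∈ V(G) := fun e he => (hst e he).left_mem
  have htmem : ∀ e ∈ E(G), t e ∈ V(G) := fun e he => (hst e he).right_mem
  have hloop : ∀ e x, ¬ G.IsLoopAt e x := by
    intro e x h
    have := hG.loopSet_eq_empty (IsLink.left_mem h)
    exact Set.eq_empty_iff_forall_notMem.1 this e h
  have hneq : ∀ e ∈ E(G), s e ≠ t e := by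
    intro e he h
    have := hst e he
    rw [h] at this
    exact hloop e _ this
  have hlink : ∀ {e x y}, G.IsLink e x y → (s e = x ∧ t e = y) ∨ (s e = y ∧ t e = x) := by
    intro e x y h
    have h1 := hst e h.edge_mem
    have h2 := G.eq_or_eq_of_isLink_of_isLink h1 h
    have h3 := G.eq_or_eq_of_isLink_of_isLink h1.symm h
    have h4 := hneq e h.edge_mem
    grind
  have hstar : ∀ v, (H.star v : Set β) = G.incidenceSet v := by
    intro v
    ext e
    rw [Finset.mem_coe, EdgeSystem.mem_star, hmemE, mem_incidenceSet]
    constructor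
    · rintro ⟨he, rfl | rfl⟩
      · exact ⟨_, hst e he⟩
      · exact ⟨_, (hst e he).symm⟩
    · rintro ⟨y, h⟩
      exact ⟨h.edge_mem, (hlink h).imp And.left And.right⟩
  have hH : H.IsRSystem r := by
    refine ⟨fun e he => hmemV.2 (hsmem e (hmemE.1 he)), fun e he => hmemV.2 (htmem e (hmemE.1 he)),
      fun e he => hneq e (hmemE.1 he), fun v hv => ?_, fun X hX hodd => ?_⟩
    · have := hG.encard_incidenceSet (hmemV.1 hv)
      rw [← hstar, Set.encard_coe_eq_coe_finsetCard] at this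
      exact_mod_cast this
    · have h1 := hG.odd_cut X (fun x hx => hmemV.1 (hX hx)) X.finite_toSet
        (by rwa [Set.ncard_coe_finset])
      have h2 : G.edgesLeaving X ⊆ H.cut X := by
        rintro e ⟨x, y, hx, hy, h⟩
        rw [Finset.mem_coe] at hx hy
        rw [Finset.mem_coe, EdgeSystem.mem_cut]
        refine ⟨hmemE.2 h.edge_mem, ?_⟩
        rcases hlink h with ⟨h1, h2⟩ | ⟨h1, h2⟩ <;> simp only [H, h1, h2] <;> tauto
      have h3 := h1.trans (Set.encard_le_encard h2)
      rw [Set.encard_coe_eq_coe_finsetCard] at h3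
      exact_mod_cast h3
  have hadj : ∀ x y, H.Adj x y → x ≠ y ∧ G.Adj x y := by
    intro x y h
    refine ⟨(hH.mem_of_adj h).2.2, ?_⟩
    obtain ⟨e, he, ⟨rfl, rfl⟩ | ⟨rfl, rfl⟩⟩ := h
    · exact ⟨e, hst e (hmemE.1 he)⟩
    · exact ⟨e, (hst e (hmemE.1 he)).symm⟩
  obtain ⟨c, hc⟩ := EdgeSystem.exists_isProper hr H hH
    (fun h => hminor (hasMinor_of_hasK4MinorOn hadj (hHV ▸ h)))
  refine ⟨fun i => {e | e ∈ E(G) ∧ c e = i}, fun i => ⟨fun e he => he.1, fun e _ => hloop e, ?_⟩,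
    fun i j hij => ?_, ?_⟩
  · rintro e ⟨he, hei⟩ f ⟨hf, hfi⟩ hef x ⟨hex, hfx⟩
    have hcx := hc x (hmemV.2 hex.vertex_mem)
    rw [hstar] at hcx
    exact hef (hcx hex hfx (hei.trans hfi.symm))
  · rw [Set.disjoint_left]
    exact fun e he hf => hij (he.2.symm.trans hf.2)
  · ext e
    simp

end Graph

theorem mainTheorem8 {α β : Type*} (G : Graph α β) (hV : G.vertexSet.Finite)
    (hE : G.edgeSet.Finite) (hne : G.vertexSet.Nonempty) (k : ℕ)
    (hG : G.IsRGraph (2 * k + 1)) (hminor : G.IsK4MinorFree) :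
    G.edgeChromaticNumber = ((2 * k + 1 : ℕ) : ℕ∞) := by
  apply le_antisymm
  · exact iInf_le (fun n : {n : ℕ // G.EdgeColourable n} => (n.1 : ℕ∞))
      ⟨2 * k + 1, Graph.edgeColourable_of_isK4MinorFree hV hE hne (by omega) hG hminor⟩
  · obtain ⟨v, hv⟩ := hne
    refine le_iInf fun n => ?_
    rw [← hG.encard_incidenceSet hv]
    exact n.2.encard_incidenceSet_le v
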